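/- Let $K$ be a field, let $n,r\ge 0$ be integers, let $G$ be a simple graph on the vertex set $[n]=\{1,\dots,n\}$, and let $A_1,\dots,A_r$ be pairwise disjoint cliques of $G$ with $A_1\cup\dots\cup A_r=[n]$, where some of the $A_i$ may be empty. For $i=1,\dots,r$ let $B_i=\{y_{i,1},\dots,y_{i,s_i}\}$ with $s_i\ge 1$, where the $y_{i,j}$ are pairwise distinct new vertices. Let $G'$ be the hybrid graph on the vertex set $[n]\cup B_1\cup\dots\cup B_r$ whose edges are the edges of $G$ together with all two-element subsets of $A_i\cup B_i$ for $i=1,\dots,r$. Let $\Delta'$ be the independence complex of $G'$, that is, the simplicial complex of all independent sets of vertices of $G'$ (including $\varnothing$, of dimension $-1$). Let $S=K[x_1,\dots,x_n,\,y_{i,j} : 1\le i\le r,\ 1\le j\le s_i]$, and let $I(G')\subset S$ be the edge ideal of $G'$, generated by the products of the two variables corresponding to the ends of each edge of $G'$. Then: (i) $\Delta'$ is pure and shellable, of dimension $r-1$. Here pure means that all facets (inclusion-maximal faces) have the same cardinality, and shellable means that the facets can be ordered as $F_1,\dots,F_t$ so that for every $2\le i\le t$ the complex $\langle F_1,\dots,F_{i-1}\rangle\cap\langle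 F_i\rangle$ is generated by a nonempty set of maximal proper faces of $F_i$. (ii) The ring $S/I(G')$ is Cohen–Macaulay of Krull dimension $r$. -/

import Mathlib

namespace CMHybrid

/-! ### Simplicial complexes -/

/-- A simplicial complex on the vertex set `V`: a family of finite subsets of `V`, closed under
taking subsets, which contains all singletons. The empty set counts as a face (it has dimension
`-1`), unlike in Mathlib's `AbstractSimplicialComplex`. -/
structure Complex (V : Type*) where
  /-- The faces, the empty one included. -/
  faces : Set (Finset V)
  empty_mem : ∅ ∈ faces
  singleton_mem : ∀ v : V, {v} ∈ faces
  down_closed : ∀ F ∈ faces, ∀ H : Finset V, H ⊆ F → H ∈ faces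

namespace Complex

variable {V : Type*}

/-- Facets are the faces that are maximal under inclusion. -/
def IsFacet (D : Complex V) (F : Finset V) : Prop :=
  Maximal (fun H => H ∈ D.faces) F

/-- A complex is pure if all its facets have the same cardinality. -/
def IsPure (D : Complex V) : Prop :=
  ∀ F H : Finset V, D.IsFacet F → D.IsFacet H → F.card = H.card

/-- `D` has dimension `d`: `d` is the maximum of `dim F = |F| - 1` over all faces `F`. -/
def HasDim (D : Complex V) (d : ℤ) : Prop :=
  IsGreatest {e : ℤ | ∃ F ∈ D.faces, e = (F.card : ℤ) - 1} d

/-- `D` is shellable: its facets can be listed without repetition as `F 0, …, F (t - 1)` so that,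
for every `i` but the first, the intersection of the complex generated by the `F j` with `j < i`
and the complex generated by `F i` is generated by a nonempty set `M` of maximal proper faces of
`F i`. The family of faces of the complex generated by a set `M` of faces is `lowerClosure M`, the
family of all subsets of members of `M`, and `H ⋖ F i` says that `H` is a maximal proper subset
of `F i`. -/
def IsShellable (D : Complex V) : Prop :=
  ∃ (t : ℕ) (F : Fin t → Finset V),
    Function.Injective F ∧ Set.range F = {H | D.IsFacet H} ∧
    ∀ i : Fin t, 0 < (i : ℕ) →
      ∃ M : Set (Finset V), M.Nonempty ∧ (∀ H ∈ M, H ⋖ F i) ∧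
        lowerClosure (F '' Set.Iio i) ⊓ lowerClosure {F i} = lowerClosure M

end Complex

/-! ### Graphs -/

/-- The independence complex of a graph: the faces are the independent sets of vertices. -/
def independenceComplex {V : Type*} (G : SimpleGraph V) : Complex V where
  faces := {F | G.IsIndepSet (F : Set V)}
  empty_mem := by simp [SimpleGraph.isIndepSet_iff]
  singleton_mem v := by simp [SimpleGraph.isIndepSet_iff]
  down_closed F hF H hHF := Set.Pairwise.mono (Finset.coe_subset.mpr hHF) hF

/-- The edge ideal of `G` in the polynomial ring over `K` with one variable for each vertex:
it is generated by the products `x_u x_v` over the edges `{u, v}` of `G`. -/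
noncomputable def edgeIdeal (K : Type*) [Field K] {V : Type*} (G : SimpleGraph V) :
    Ideal (MvPolynomial V K) :=
  Ideal.span {p | ∃ u v : V, G.Adj u v ∧ p = MvPolynomial.X u * MvPolynomial.X v}

/-- The vertices of a hybrid graph: the old vertices `x_a` for `a : Fin n`, together with new
vertices `y_{i,j}` for `i : Fin r` and `j : Fin (s i)`. -/
abbrev HybridVertex (n : ℕ) {r : ℕ} (s : Fin r → ℕ) : Type :=
  Fin n ⊕ (Σ i : Fin r, Fin (s i))

/-- The set `A_i ∪ B_i`, where `B_i = {y_{i,j} : j}` consists of `s i` new vertices. -/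
def block {n r : ℕ} (A : Fin r → Set (Fin n)) (s : Fin r → ℕ) (i : Fin r) :
    Set (HybridVertex n s) :=
  Sum.inl '' A i ∪ Set.range (fun j : Fin (s i) => Sum.inr ⟨i, j⟩)

/-- The hybrid graph: the edges of `G`, together with all two-element subsets of the sets
`A_i ∪ B_i`. -/
def hybridGraph {n r : ℕ} (G : SimpleGraph (Fin n)) (A : Fin r → Set (Fin n)) (s : Fin r → ℕ) :
    SimpleGraph (HybridVertex n s) where
  Adj u v := (∃ a b : Fin n, G.Adj a b ∧ u = Sum.inl a ∧ v = Sum.inl b) ∨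
    ∃ i : Fin r, u ∈ block A s i ∧ v ∈ block A s i ∧ u ≠ v
  symm := ⟨by
    rintro u v (⟨a, b, h, hu, hv⟩ | ⟨i, hu, hv, hne⟩)
    · exact Or.inl ⟨b, a, h.symm, hv, hu⟩
    · exact Or.inr ⟨i, hv, hu, hne.symm⟩⟩
  loopless := ⟨by
    rintro u (⟨a, b, h, hu, hv⟩ | ⟨i, hu, hv, hne⟩)
    · exact h.ne (Sum.inl_injective (hu.symm.trans hv))
    · exact hne rfl⟩

/-! ### Cohen–Macaulay rings -/

/-- The depth of a local ring: the supremum of the lengths of the regular sequences contained in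
its maximal ideal. -/
noncomputable def localDepth (R : Type*) [CommRing R] [IsLocalRing R] : ℕ∞ :=
  ⨆ (rs : List R) (_ : (∀ x ∈ rs, x ∈ IsLocalRing.maximalIdeal R) ∧
    RingTheory.Sequence.IsRegular R rs), (rs.length : ℕ∞)

/-- A Cohen–Macaulay local ring: a Noetherian local ring whose depth is its Krull dimension. -/
def IsCohenMacaulayLocal (R : Type*) [CommRing R] [IsLocalRing R] : Prop :=
  IsNoetherianRing R ∧ (localDepth R : WithBot ℕ∞) = ringKrullDim R

/-- A Cohen–Macaulay ring: a Noetherian ring whose localizations at all maximal ideals are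
Cohen–Macaulay local rings. -/
def IsCohenMacaulay (R : Type*) [CommRing R] : Prop :=
  IsNoetherianRing R ∧
    ∀ (m : Ideal R) [m.IsMaximal], IsCohenMacaulayLocal (Localization.AtPrime m)

end CMHybrid

/-! The blocks A_i ∪ B_i partition the vertices into r cliques, and y_{i,1} has no neighbour outside
its block; `SimplicialPartition` keeps only this. An independent set meets each clique at most once,
and a missed clique can be filled by its apex. So the facets are the independent transversals, of
size r, and each is determined by its non-apex part, its core. Listing facets by increasing core
size is a shelling.

Cohen–Macaulayness is proved without the shelling. Let θ_i be the sum of the variables of clique i.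
The squarefree monomials of the apex-free independent sets form a finite basis of the edge ring over
K[θ_1, …, θ_r] (`finite_and_free`). A nonzero finite flat algebra over a polynomial ring in r
variables is Cohen–Macaulay of dimension r: flatness carries regular sequences up, integrality
bounds the dimension. -/

namespace CMHybrid

open RingTheory.Sequence
open scoped Pointwise

/-! ### Finite flat algebras over polynomial rings -/

/-- A regular sequence in a local ring is at most as long as the Krull dimension. -/
theorem localDepth_le_ringKrullDim (R : Type*) [CommRing R] [IsLocalRing R] [IsNoetherianRing R] :
    (localDepth R : WithBot ℕ∞) ≤ ringKrullDim R := by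
  obtain ⟨d, hd⟩ : ∃ d : ℕ∞, (d : WithBot ℕ∞) = ringKrullDim R := by
    rw [← IsLocalRing.maximalIdeal_height_eq_ringKrullDim]
    exact ⟨_, rfl⟩
  rw [← hd, WithBot.coe_le_coe]
  refine iSup₂_le fun rs hrs ↦ ?_
  rw [← WithBot.coe_le_coe, hd, ← ringKrullDim_add_length_eq_ringKrullDim_of_isRegular rs hrs.2]
  have : Nontrivial (R ⧸ Ideal.ofList rs) :=
    Ideal.Quotient.nontrivial_iff.mpr fun h ↦ hrs.2.top_ne_smul (by simp [h])
  exact le_add_of_nonneg_left ringKrullDim_nonneg_of_nontrivial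

/-- Weakly regular sequences of the base ring remain so on flat modules. -/
theorem isWeaklyRegular_of_flat {R M : Type*} [CommRing R] [AddCommGroup M] [Module R M]
    [Module.Flat R M] {rs : List R} (h : IsWeaklyRegular R rs) : IsWeaklyRegular M rs :=
  ((TensorProduct.rid R M).isWeaklyRegular_congr rs).mp h.isWeaklyRegular_lTensor

/-- A monic polynomial followed by a weakly regular sequence of constants. -/
theorem isWeaklyRegular_monic_cons {A : Type*} [CommRing A] {g : Polynomial A} (hg : g.Monic)
    {rs : List A} (h : IsWeaklyRegular A rs) :
    IsWeaklyRegular (Polynomial A) (g :: rs.map Polynomial.C) := by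
  refine IsWeaklyRegular.cons ?_ ?_
  · exact fun a b hab ↦ hg.isRegular.left hab
  · have hspan : Ideal.span {g} = g • (⊤ : Ideal (Polynomial A)) := by
      simp [← Submodule.ideal_span_singleton_smul]
    have e : AdjoinRoot g ≃ₗ[A] QuotSMulTop g (Polynomial A) :=
      (Submodule.quotEquivOfEq _ _ hspan).restrictScalars A
    -- As `g` is monic, `A[X]/(g)` is free over `A`, so flatness keeps `rs` weakly regular on it.
    have := hg.free_adjoinRoot
    have : Module.Flat A (QuotSMulTop g (Polynomial A)) := Module.Flat.of_linearEquiv e.symm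
    exact (isWeaklyRegular_map_algebraMap_iff (S := Polynomial A) _ rs).mpr
      (isWeaklyRegular_of_flat h)

/-- Monic polynomials in pairwise different variables form a weakly regular sequence. -/
theorem isWeaklyRegular_ofFn_aeval_X (K : Type*) [CommRing K] :
    ∀ (r : ℕ) (f : Fin r → Polynomial K), (∀ i, (f i).Monic) →
      IsWeaklyRegular (MvPolynomial (Fin r) K)
        (List.ofFn fun i ↦ Polynomial.aeval (MvPolynomial.X i : MvPolynomial (Fin r) K) (f i))
  | 0, f, _ => by simp
  | r + 1, f, hf => by
    have ih := isWeaklyRegular_ofFn_aeval_X K r (fun i ↦ f i.succ) fun i ↦ hf i.succ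
    have key := isWeaklyRegular_monic_cons
      ((hf 0).map (MvPolynomial.C : K →+* MvPolynomial (Fin r) K)) ih
    let e := MvPolynomial.finSuccEquiv K r
    refine (e.toRingEquiv.toAddEquiv.isWeaklyRegular_congr ?_).mpr key
    rw [List.ofFn_succ, List.forall₂_cons]
    constructor
    · intro x
      have : e (Polynomial.aeval (MvPolynomial.X 0) (f 0)) = (f 0).map MvPolynomial.C := by
        rw [← Polynomial.aeval_algHom_apply, MvPolynomial.finSuccEquiv_X_zero,
          Polynomial.aeval_def, Polynomial.eval₂_eq_eval_map]
        conv_rhs => rw [← Polynomial.eval₂_C_X (p := (f 0).map MvPolynomial.C)]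
        rw [Polynomial.eval₂_map, Polynomial.eval_map]
        rfl
      change e (_ * x) = _ * e x
      rw [map_mul, this]
    · rw [List.map_ofFn, List.forall₂_iff_get]
      refine ⟨by simp, fun i h₁ h₂ x ↦ ?_⟩
      simp only [List.get_ofFn, Function.comp]
      change e (_ * x) = _ * e x
      rw [map_mul]
      congr 1
      rw [← Polynomial.aeval_algHom_apply, MvPolynomial.finSuccEquiv_X_succ]
      exact Polynomial.aeval_algHom_apply
        (Polynomial.CAlgHom (R := K) (A := MvPolynomial (Fin r) K)) _ _

/-- Modulo a maximal ideal of a polynomial ring over a field, each variable is a root of a monic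
polynomial over the field. -/
theorem exists_monic_aeval_X_mem {K : Type*} [Field K] {σ : Type*} [Finite σ]
    (n : Ideal (MvPolynomial σ K)) [n.IsMaximal] (i : σ) :
    ∃ f : Polynomial K, f.Monic ∧
      Polynomial.aeval (MvPolynomial.X i : MvPolynomial σ K) f ∈ n := by
  let := Ideal.Quotient.field n
  -- Zariski's lemma: the residue field is finite over `K`.
  have := finite_of_finite_type_of_isJacobsonRing K (MvPolynomial σ K ⧸ n)
  obtain ⟨f, hf, h0⟩ := Algebra.IsIntegral.isIntegral (R := K)
    (Ideal.Quotient.mkₐ K n (MvPolynomial.X i))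
  refine ⟨f, hf, ?_⟩
  rw [← Ideal.Quotient.eq_zero_iff_mem]
  change Ideal.Quotient.mkₐ K n _ = 0
  rw [← Polynomial.aeval_algHom_apply]
  exact h0

/-- Krull dimension does not increase along integral extensions. -/
theorem ringKrullDim_le_of_isIntegral (A B : Type*) [CommRing A] [CommRing B] [Algebra A B]
    [Algebra.IsIntegral A B] : ringKrullDim B ≤ ringKrullDim A :=
  Order.krullDim_le_of_strictMono (PrimeSpectrum.comap (algebraMap A B)) fun _ _ h ↦
    Ideal.IsIntegral.comap_lt_comap (R := A) h

/-- A nonzero ring that is finite and flat over a polynomial ring in `r` variables over a field is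
Cohen–Macaulay of dimension `r`. -/
theorem isCohenMacaulay_of_finite_flat (K : Type*) [Field K] (r : ℕ) (R : Type*) [CommRing R]
    [Nontrivial R] [Algebra (MvPolynomial (Fin r) K) R] [Module.Finite (MvPolynomial (Fin r) K) R]
    [Module.Flat (MvPolynomial (Fin r) K) R] :
    IsCohenMacaulay R ∧ ringKrullDim R = (r : WithBot ℕ∞) := by
  have hN : IsNoetherianRing R := IsNoetherianRing.of_finite (MvPolynomial (Fin r) K) R
  have hdim : ringKrullDim R ≤ (r : WithBot ℕ∞) := by
    refine (ringKrullDim_le_of_isIntegral (MvPolynomial (Fin r) K) R).trans ?_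
    simp
  have hloc (m : Ideal R) [m.IsMaximal] : IsNoetherianRing (Localization.AtPrime m) :=
    IsLocalization.isNoetherianRing m.primeCompl _ hN
  have hdepth (m : Ideal R) [m.IsMaximal] : (r : ℕ∞) ≤ localDepth (Localization.AtPrime m) := by
    have : (m.comap (algebraMap (MvPolynomial (Fin r) K) R)).IsMaximal :=
      Ideal.isMaximal_comap_of_isIntegral_of_isMaximal m
    choose f hf hfm using
      exists_monic_aeval_X_mem (m.comap (algebraMap (MvPolynomial (Fin r) K) R))
    have hreg := (isWeaklyRegular_ofFn_aeval_X K r f hf).of_flat (S := R)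
    have hmem : ∀ x ∈ (List.ofFn fun i ↦ Polynomial.aeval
        (MvPolynomial.X i : MvPolynomial (Fin r) K) (f i)).map (algebraMap _ R), x ∈ m := by
      simp only [List.mem_map, List.mem_ofFn]
      rintro _ ⟨_, ⟨i, rfl⟩, rfl⟩
      exact hfm i
    have := hreg.isRegular_of_isLocalization_of_mem (Localization.AtPrime m) m hmem
    refine le_trans ?_ (le_iSup₂_of_le _ ⟨?_, this⟩ le_rfl)
    · simp
    · simp only [List.mem_map]
      rintro _ ⟨x, hx, rfl⟩
      exact (IsLocalization.AtPrime.to_map_mem_maximal_iff _ m x).mpr (hmem x (by simpa using hx))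
  have hle (m : Ideal R) [m.IsMaximal] : ringKrullDim (Localization.AtPrime m) ≤ ringKrullDim R := by
    rw [IsLocalization.AtPrime.ringKrullDim_eq_height m]
    exact Ideal.height_le_ringKrullDim_of_isPrime
  have hge (m : Ideal R) [m.IsMaximal] :
      (r : WithBot ℕ∞) ≤ (localDepth (Localization.AtPrime m) : WithBot ℕ∞) :=
    WithBot.coe_le_coe.mpr (hdepth m)
  -- The chain r ≤ depth R_m ≤ dim R_m ≤ dim R ≤ r collapses to equalities.
  refine ⟨⟨hN, fun m _ ↦ ⟨hloc m, (localDepth_le_ringKrullDim _).antisymm ?_⟩⟩, hdim.antisymm ?_⟩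
  · exact ((hle m).trans hdim).trans (hge m)
  · obtain ⟨m, hm⟩ := Ideal.exists_maximal R
    exact ((hge m).trans (localDepth_le_ringKrullDim _)).trans (hle m)

/-! ### Facets and shelling -/

/-- A partition of the vertices of `H` into cliques, indexed by `Fin r`, each of which contains a
vertex `apex i` with no neighbours outside its clique. -/
structure SimplicialPartition {V : Type*} (H : SimpleGraph V) (r : ℕ) where
  /-- The index of the clique of a vertex. -/
  idx : V → Fin r
  /-- The chosen vertex of each clique. -/
  apex : Fin r → V
  idx_apex : ∀ i, idx (apex i) = i
  adj_of_idx_eq : ∀ u v, u ≠ v → idx u = idx v → H.Adj u v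
  idx_eq_of_adj_apex : ∀ i v, H.Adj (apex i) v → idx v = i

namespace SimplicialPartition

variable {V : Type*} [DecidableEq V] {H : SimpleGraph V} {r : ℕ} (p : SimplicialPartition H r)

omit [DecidableEq V] in
theorem eq_of_idx_eq {F : Finset V} (hF : H.IsIndepSet (F : Set V)) {u v : V} (hu : u ∈ F)
    (hv : v ∈ F) (h : p.idx u = p.idx v) : u = v := by
  by_contra hne
  exact hF hu hv hne (p.adj_of_idx_eq u v hne h)

/-- The non-apex vertices of a set. -/
def core (F : Finset V) : Finset V := F.filter fun v ↦ ∀ i, p.apex i ≠ v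

/-- Adds the apexes of all cliques that a set misses. -/
def fill (F : Finset V) : Finset V :=
  F ∪ (Finset.univ.filter fun i ↦ ∀ v ∈ F, p.idx v ≠ i).image p.apex

theorem mem_fill {F : Finset V} {v : V} :
    v ∈ p.fill F ↔ v ∈ F ∨ ∃ i, (∀ u ∈ F, p.idx u ≠ i) ∧ p.apex i = v := by
  simp [fill]

theorem subset_fill (F : Finset V) : F ⊆ p.fill F := Finset.subset_union_left

/-- An added apex has neighbours only in its own clique, which `F` misses and which receives no
other new vertex. -/
theorem isIndepSet_fill {F : Finset V} (hF : H.IsIndepSet (F : Set V)) :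
    H.IsIndepSet (p.fill F : Set V) := by
  intro u hu v hv hne hadj
  rw [Finset.mem_coe, mem_fill] at hu hv
  rcases hu with hu | ⟨i, hi, rfl⟩
  · rcases hv with hv | ⟨j, hj, rfl⟩
    · exact hF hu hv hne hadj
    · exact hj u hu (p.idx_eq_of_adj_apex j u hadj.symm)
  · have hvi := p.idx_eq_of_adj_apex i v hadj
    rcases hv with hv | ⟨j, hj, rfl⟩
    · exact hi v hv hvi
    · rw [p.idx_apex] at hvi
      exact hne (by rw [hvi])

theorem exists_mem_fill_idx_eq (F : Finset V) (i : Fin r) : ∃ v ∈ p.fill F, p.idx v = i := by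
  by_cases h : ∀ u ∈ F, p.idx u ≠ i
  · exact ⟨p.apex i, p.mem_fill.mpr (Or.inr ⟨i, h, rfl⟩), p.idx_apex i⟩
  · push Not at h
    obtain ⟨u, hu, hi⟩ := h
    exact ⟨u, p.subset_fill F hu, hi⟩

include p in
omit [DecidableEq V] in
theorem card_le {F : Finset V} (hF : H.IsIndepSet (F : Set V)) : F.card ≤ r := by
  have := Finset.card_le_card_of_injOn (s := F) (t := Finset.univ) p.idx (by simp)
    fun u hu v hv h ↦ p.eq_of_idx_eq hF hu hv h
  simpa using this

/-- A maximal `F` absorbs `p.fill F`, which meets every clique. Conversely, any further vertex would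
share a clique with a vertex of `F`. -/
theorem isFacet_iff {F : Finset V} :
    (independenceComplex H).IsFacet F ↔
      H.IsIndepSet (F : Set V) ∧ ∀ i, ∃ v ∈ F, p.idx v = i := by
  constructor
  · intro h
    refine ⟨h.prop, fun i ↦ ?_⟩
    obtain ⟨v, hv, hi⟩ := p.exists_mem_fill_idx_eq F i
    exact ⟨v, h.le_of_ge (p.isIndepSet_fill h.prop) (p.subset_fill F) hv, hi⟩
  · rintro ⟨hF, h⟩
    refine ⟨hF, fun E hE hFE v hv ↦ ?_⟩
    obtain ⟨u, hu, hi⟩ := h (p.idx v)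
    rwa [← p.eq_of_idx_eq hE (hFE hu) hv hi]

theorem isFacet_fill {F : Finset V} (hF : H.IsIndepSet (F : Set V)) :
    (independenceComplex H).IsFacet (p.fill F) :=
  p.isFacet_iff.mpr ⟨p.isIndepSet_fill hF, p.exists_mem_fill_idx_eq F⟩

include p in
theorem card_of_isFacet {F : Finset V} (h : (independenceComplex H).IsFacet F) : F.card = r := by
  obtain ⟨hF, h⟩ := p.isFacet_iff.mp h
  refine (p.card_le hF).antisymm ?_
  have : (Finset.univ : Finset (Fin r)) ⊆ F.image p.idx := fun i _ ↦ by simpa using h i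
  simpa using (Finset.card_le_card this).trans Finset.card_image_le

theorem fill_core {F : Finset V} (h : (independenceComplex H).IsFacet F) :
    p.fill (p.core F) = F := by
  obtain ⟨hF, hi⟩ := p.isFacet_iff.mp h
  ext v
  rw [mem_fill]
  constructor
  · rintro (hv | ⟨i, hv, rfl⟩)
    · exact (Finset.mem_filter.mp hv).1
    · obtain ⟨u, hu, hui⟩ := hi i
      by_cases hc : u ∈ p.core F
      · exact absurd hui (hv u hc)
      · simp only [core, Finset.mem_filter, hu, true_and, not_forall, not_not] at hc
        obtain ⟨j, rfl⟩ := hc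
        rw [p.idx_apex] at hui
        rwa [← hui]
  · intro hv
    by_cases hc : v ∈ p.core F
    · exact Or.inl hc
    · refine Or.inr ?_
      have hc' := hc
      simp only [core, Finset.mem_filter, hv, true_and, not_forall, not_not] at hc'
      obtain ⟨j, rfl⟩ := hc'
      refine ⟨j, fun u hu huj ↦ hc ?_, rfl⟩
      rwa [← p.eq_of_idx_eq hF (Finset.mem_filter.mp hu).1 hv (huj.trans (p.idx_apex j).symm)]

include p in
theorem isPure : (independenceComplex H).IsPure := fun _ _ h₁ h₂ ↦
  (p.card_of_isFacet h₁).trans (p.card_of_isFacet h₂).symm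

include p in
theorem hasDim : (independenceComplex H).HasDim ((r : ℤ) - 1) := by
  constructor
  · have h := p.isFacet_fill (F := ∅) (independenceComplex H).empty_mem
    exact ⟨_, h.prop, by rw [p.card_of_isFacet h]⟩
  · rintro _ ⟨F, hF, rfl⟩
    have := p.card_le hF
    omega

/-- A facet with at most as many non-apex vertices misses a non-apex vertex of any other. -/
theorem exists_mem_core_notMem {E F : Finset V} (hE : (independenceComplex H).IsFacet E)
    (hF : (independenceComplex H).IsFacet F) (hne : E ≠ F)
    (hcard : (p.core E).card ≤ (p.core F).card) : ∃ v ∈ p.core F, v ∉ E := by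
  by_contra! h
  have hsub : p.core F ⊆ p.core E := fun v hv ↦
    Finset.mem_filter.mpr ⟨h v hv, (Finset.mem_filter.mp hv).2⟩
  have := Finset.eq_of_subset_of_card_le hsub hcard
  exact hne (by rw [← p.fill_core hE, ← p.fill_core hF, this])

/-- Replacing a non-apex vertex of a facet by the apex of its clique gives a facet with fewer
non-apex vertices. -/
theorem exists_isFacet_erase_subset {F : Finset V} (hF : (independenceComplex H).IsFacet F) {v : V}
    (hv : v ∈ p.core F) : ∃ E, (independenceComplex H).IsFacet E ∧ F.erase v ⊆ E ∧
      (p.core E).card < (p.core F).card := by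
  have hind : H.IsIndepSet (F.erase v : Set V) :=
    (independenceComplex H).down_closed F hF.prop _ (Finset.erase_subset _ _)
  refine ⟨p.fill (F.erase v), p.isFacet_fill hind, p.subset_fill _, ?_⟩
  have hsub : p.core (p.fill (F.erase v)) ⊆ (p.core F).erase v := by
    intro u hu
    obtain ⟨hu, hu'⟩ := Finset.mem_filter.mp hu
    rcases p.mem_fill.mp hu with h | ⟨i, _, rfl⟩
    · rw [Finset.mem_erase] at h
      exact Finset.mem_erase.mpr ⟨h.1, Finset.mem_filter.mpr ⟨h.2, hu'⟩⟩
    · exact absurd rfl (hu' i)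
  exact (Finset.card_le_card hsub).trans_lt (Finset.card_erase_lt_of_mem hv)

-- Sort facets by core size. An earlier facet misses some core vertex v of the current facet F, so
-- it meets F inside F \ {v}. Conversely, F \ {v} lies in a facet with smaller core, which comes
-- earlier.
include p in
theorem isShellable [Fintype V] : (independenceComplex H).IsShellable := by
  classical
  let S : Type _ := {F : Finset V // (independenceComplex H).IsFacet F}
  let e : Fin (Fintype.card S) ≃ S := (Fintype.equivFin S).symm
  let g : Fin (Fintype.card S) → ℕ := fun i ↦ (p.core (e i).1).card
  let σ := Tuple.sort g
  have hmono : Monotone (g ∘ σ) := Tuple.monotone_sort g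
  refine ⟨Fintype.card S, fun i ↦ (e (σ i)).1, fun i j h ↦ ?_, ?_, fun i hi ↦ ?_⟩
  · exact σ.injective (e.injective (Subtype.ext h))
  · ext F
    constructor
    · rintro ⟨i, rfl⟩
      exact (e (σ i)).2
    · intro h
      exact ⟨σ.symm (e.symm ⟨F, h⟩), by simp⟩
  have hsep : ∀ j < i, ∃ v ∈ p.core (e (σ i)).1, v ∉ (e (σ j)).1 := fun j hj ↦
    p.exists_mem_core_notMem (e (σ j)).2 (e (σ i)).2
      (fun h ↦ hj.ne (σ.injective (e.injective (Subtype.ext h)))) (hmono hj.le)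
  refine ⟨{E | ∃ v ∈ p.core (e (σ i)).1, E = (e (σ i)).1.erase v}, ?_, ?_, ?_⟩
  · obtain ⟨v, hv, -⟩ := hsep ⟨0, hi.trans i.2⟩ hi
    exact ⟨_, v, hv, rfl⟩
  · rintro _ ⟨v, hv, rfl⟩
    exact Finset.erase_covBy (Finset.mem_filter.mp hv).1
  · ext E
    simp only [SetLike.mem_coe, LowerSet.mem_inf_iff, mem_lowerClosure, Set.mem_image, Set.mem_Iio,
      Set.mem_singleton_iff, Set.mem_ofPred_eq, exists_exists_and_eq_and, exists_eq_left]
    constructor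
    · rintro ⟨⟨j, hj, hEj⟩, hEi⟩
      obtain ⟨v, hv, hvj⟩ := hsep j hj
      exact ⟨_, ⟨v, hv, rfl⟩, Finset.subset_erase.mpr ⟨hEi, fun h ↦ hvj (hEj h)⟩⟩
    · rintro ⟨_, ⟨v, hv, rfl⟩, hE⟩
      refine ⟨?_, hE.trans (Finset.erase_subset _ _)⟩
      obtain ⟨F, hF, hsub, hlt⟩ := p.exists_isFacet_erase_subset (e (σ i)).2 hv
      refine ⟨σ.symm (e.symm ⟨F, hF⟩), ?_, ?_⟩
      · by_contra hle
        have := hmono (not_lt.mp hle)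
        simp only [Function.comp, g, Equiv.apply_symm_apply] at this
        omega
      · simpa using hE.trans hsub

end SimplicialPartition

/-! ### The edge ring as a free module -/

/-- The quotient of the polynomial ring by the edge ideal. -/
def EdgeRing (K : Type*) [Field K] {V : Type*} (H : SimpleGraph V) : Type _ :=
  MvPolynomial V K ⧸ edgeIdeal K H

noncomputable instance (K : Type*) [Field K] {V : Type*} (H : SimpleGraph V) :
    CommRing (EdgeRing K H) := inferInstanceAs (CommRing (MvPolynomial V K ⧸ edgeIdeal K H))

noncomputable instance (K : Type*) [Field K] {V : Type*} (H : SimpleGraph V) :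
    Algebra K (EdgeRing K H) := inferInstanceAs (Algebra K (MvPolynomial V K ⧸ edgeIdeal K H))

/-- The quotient map onto the edge ring. -/
noncomputable def EdgeRing.mk (K : Type*) [Field K] {V : Type*} (H : SimpleGraph V) :
    MvPolynomial V K →ₐ[K] EdgeRing K H := Ideal.Quotient.mkₐ K (edgeIdeal K H)

theorem EdgeRing.mk_surjective (K : Type*) [Field K] {V : Type*} (H : SimpleGraph V) :
    Function.Surjective (EdgeRing.mk K H) := Ideal.Quotient.mk_surjective

theorem EdgeRing.mk_eq_zero (K : Type*) [Field K] {V : Type*} (H : SimpleGraph V)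
    {q : MvPolynomial V K} (hq : q ∈ edgeIdeal K H) : EdgeRing.mk K H q = 0 :=
  Ideal.Quotient.eq_zero_iff_mem.mpr hq

/-- The class of a variable modulo the edge ideal. -/
noncomputable def vertexVar (K : Type*) [Field K] {V : Type*} (H : SimpleGraph V) (v : V) :
    EdgeRing K H := EdgeRing.mk K H (MvPolynomial.X v)

theorem vertexVar_mul_of_adj (K : Type*) [Field K] {V : Type*} {H : SimpleGraph V} {u v : V}
    (h : H.Adj u v) : vertexVar K H u * vertexVar K H v = 0 := by
  rw [vertexVar, vertexVar, ← map_mul]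
  exact EdgeRing.mk_eq_zero K H (Ideal.subset_span ⟨u, v, h, rfl⟩)

namespace SimplicialPartition

variable {V : Type*} [Fintype V] [DecidableEq V] {H : SimpleGraph V} {r : ℕ}
  (p : SimplicialPartition H r) (K : Type*) [Field K]

/-- The homomorphism that sends the `i`-th variable to the sum of the variables of clique `i`. -/
noncomputable def paramHom :
    MvPolynomial (Fin r) K →ₐ[K] EdgeRing K H :=
  MvPolynomial.aeval fun i ↦ ∑ v with p.idx v = i, vertexVar K H v

omit [DecidableEq V] in
theorem paramHom_X (i : Fin r) :
    p.paramHom K (MvPolynomial.X i) = ∑ v with p.idx v = i, vertexVar K H v :=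
  MvPolynomial.aeval_X _ _

-- Cross terms vanish because distinct vertices of a clique are adjacent. This lets the parameters
-- absorb squares of variables.
omit [DecidableEq V] in
theorem paramHom_X_mul_vertexVar (v : V) :
    p.paramHom K (MvPolynomial.X (p.idx v)) * vertexVar K H v =
      vertexVar K H v * vertexVar K H v := by
  rw [paramHom_X, Finset.sum_mul, Finset.sum_eq_single v]
  · intro u hu hne
    exact vertexVar_mul_of_adj K (p.adj_of_idx_eq u v hne (Finset.mem_filter.mp hu).2)
  · simp

/-- Restriction to a face, where each variable becomes the parameter of its clique. -/
noncomputable def evalFace (F : Finset V) (hF : H.IsIndepSet (F : Set V)) :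
    EdgeRing K H →ₐ[K] MvPolynomial (Fin r) K :=
  Ideal.Quotient.liftₐ (edgeIdeal K H)
    (MvPolynomial.aeval fun v ↦ if v ∈ F then MvPolynomial.X (p.idx v) else 0) <| by
      intro a ha
      rw [← RingHom.mem_ker]
      revert a
      change edgeIdeal K H ≤ _
      refine Ideal.span_le.mpr ?_
      rintro _ ⟨u, v, h, rfl⟩
      simp only [SetLike.mem_coe, RingHom.mem_ker, map_mul, MvPolynomial.aeval_X]
      by_cases hu : u ∈ F
      · by_cases hv : v ∈ F
        · exact absurd h (hF hu hv h.ne)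
        · simp [hv]
      · simp [hu]

omit [Fintype V] in
theorem evalFace_vertexVar (F : Finset V) (hF : H.IsIndepSet (F : Set V)) (v : V) :
    p.evalFace K F hF (vertexVar K H v) = if v ∈ F then MvPolynomial.X (p.idx v) else 0 :=
  MvPolynomial.aeval_X _ _

/-- A facet has exactly one vertex in each clique, so each parameter restricts to a single variable.
-/
theorem evalFace_paramHom {F : Finset V} (hF : H.IsIndepSet (F : Set V))
    (hF' : (independenceComplex H).IsFacet F) (q : MvPolynomial (Fin r) K) :
    p.evalFace K F hF (p.paramHom K q) = q := by
  suffices h : (p.evalFace K F hF).comp (p.paramHom K) = AlgHom.id K _ from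
    DFunLike.congr_fun h q
  ext i : 1
  obtain ⟨v, hv, rfl⟩ := (p.isFacet_iff.mp hF').2 i
  rw [AlgHom.comp_apply, paramHom_X, map_sum, Finset.sum_eq_single v]
  · simp [evalFace_vertexVar, hv]
  · intro u hu hne
    rw [evalFace_vertexVar, if_neg]
    exact fun huF ↦ hne (p.eq_of_idx_eq hF huF hv (Finset.mem_filter.mp hu).2)
  · simp

omit [Fintype V] in
theorem evalFace_prod (F : Finset V) (hF : H.IsIndepSet (F : Set V)) (E : Finset V) :
    p.evalFace K F hF (∏ v ∈ E, vertexVar K H v) =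
      if E ⊆ F then ∏ v ∈ E, MvPolynomial.X (p.idx v) else 0 := by
  rw [map_prod]
  split_ifs with h
  · exact Finset.prod_congr rfl fun v hv ↦ by rw [evalFace_vertexVar, if_pos (h hv)]
  · obtain ⟨v, hv, hvF⟩ := Finset.not_subset.mp h
    exact Finset.prod_eq_zero hv (by rw [evalFace_vertexVar, if_neg hvF])

/-- The independent sets without apexes. -/
abbrev CoreFace : Type _ :=
  {E : Finset V // H.IsIndepSet (E : Set V) ∧ ∀ v ∈ E, ∀ i, p.apex i ≠ v}

omit [Fintype V] in
theorem subset_fill_iff (E F : p.CoreFace) : E.1 ⊆ p.fill F.1 ↔ E.1 ⊆ F.1 := by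
  refine ⟨fun h v hv ↦ ?_, fun h ↦ h.trans (p.subset_fill _)⟩
  rcases p.mem_fill.mp (h hv) with h | ⟨i, -, hi⟩
  · exact h
  · exact absurd hi (E.2.2 v hv i)

/-- Restriction to the facet `p.fill E` kills the terms of all D ⊄ E, and induction on size kills
those of D ⊊ E. What remains is `g E` times a nonzero monomial. -/
theorem sum_paramHom_mul_prod_eq_zero (s : Finset p.CoreFace)
    (g : p.CoreFace → MvPolynomial (Fin r) K)
    (h : ∑ E ∈ s, p.paramHom K (g E) * ∏ v ∈ E.1, vertexVar K H v = 0) : ∀ E ∈ s, g E = 0 := by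
  suffices ∀ (n : ℕ) (E : p.CoreFace), E.1.card = n → E ∈ s → g E = 0 from
    fun E hE ↦ this _ E rfl hE
  intro n
  induction n using Nat.strong_induction_on with
  | _ n ih =>
    rintro E rfl hE
    have hF := p.isFacet_fill E.2.1
    have h0 := congrArg (p.evalFace K _ (p.isIndepSet_fill E.2.1)) h
    simp only [map_sum, map_mul, p.evalFace_paramHom K _ hF, evalFace_prod, map_zero, subset_fill_iff]
      at h0
    rw [Finset.sum_eq_single E] at h0
    · rw [if_pos subset_rfl] at h0
      refine (mul_eq_zero.mp h0).resolve_right (Finset.prod_ne_zero_iff.mpr fun v _ ↦ ?_)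
      exact MvPolynomial.X_ne_zero _
    · intro D hD hne
      by_cases hDE : D.1 ⊆ E.1
      · have hlt : D.1.card < E.1.card :=
          Finset.card_lt_card (hDE.ssubset_of_ne fun h ↦ hne (Subtype.ext h))
        rw [ih _ hlt D rfl hD, zero_mul]
      · rw [if_neg hDE, mul_zero]
    · exact fun h ↦ absurd hE h

theorem finite_and_free : letI := (p.paramHom K).toRingHom.toAlgebra
    Module.Finite (MvPolynomial (Fin r) K) (EdgeRing K H) ∧
      Module.Free (MvPolynomial (Fin r) K) (EdgeRing K H) := by
  let := (p.paramHom K).toRingHom.toAlgebra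
  have smul_def (q : MvPolynomial (Fin r) K) (x : EdgeRing K H) :
      q • x = p.paramHom K q * x := rfl
  let b : p.CoreFace → EdgeRing K H := fun E ↦ ∏ v ∈ E.1, vertexVar K H v
  have hli : LinearIndependent (MvPolynomial (Fin r) K) b :=
    linearIndependent_iff'.mpr fun s g h ↦ p.sum_paramHom_mul_prod_eq_zero K s g h
  let N := Submodule.span (MvPolynomial (Fin r) K) (Set.range b)
  -- Multiplying the monomial of E by a non-apex v gives a parameter multiple (v ∈ E), zero (v
  -- adjacent to E), or the monomial of E ∪ {v}.
  have hcore (v : V) (hv : ∀ i, p.apex i ≠ v) (x) (hx : x ∈ N) : vertexVar K H v * x ∈ N := by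
    induction hx using Submodule.span_induction with
    | zero => simp
    | add x y _ _ hx hy => simpa [mul_add] using add_mem hx hy
    | smul q x _ hx =>
      rw [smul_def, mul_left_comm, ← smul_def]
      exact N.smul_mem q hx
    | mem x hx =>
      obtain ⟨E, rfl⟩ := hx
      by_cases hvE : v ∈ E.1
      · have : vertexVar K H v * b E = (MvPolynomial.X (p.idx v) : MvPolynomial (Fin r) K) • b E := by
          simp only [b, smul_def]
          rw [← Finset.mul_prod_erase _ _ hvE, ← mul_assoc, ← mul_assoc,
            paramHom_X_mul_vertexVar]
        rw [this]
        exact N.smul_mem _ (Submodule.subset_span ⟨E, rfl⟩)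
      by_cases hadj : ∃ u ∈ E.1, H.Adj v u
      · obtain ⟨u, hu, h⟩ := hadj
        simp only [b]
        rw [← Finset.mul_prod_erase _ _ hu, ← mul_assoc, vertexVar_mul_of_adj K h, zero_mul]
        exact N.zero_mem
      · push Not at hadj
        refine Submodule.subset_span ⟨⟨insert v E.1, ?_, ?_⟩, Finset.prod_insert hvE⟩
        · rw [Finset.coe_insert]
          exact E.2.1.insert fun u hu _ ↦ ⟨hadj u hu, fun h ↦ hadj u hu h.symm⟩
        · simpa [hv] using E.2.2
  have hvar (v : V) (x) (hx : x ∈ N) : vertexVar K H v * x ∈ N := by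
    by_cases hv : ∀ i, p.apex i ≠ v
    · exact hcore v hv x hx
    push Not at hv
    obtain ⟨i, rfl⟩ := hv
    -- An apex variable is its parameter minus the other, non-apex, variables of the clique.
    have : vertexVar K H (p.apex i) = p.paramHom K (MvPolynomial.X i) -
        ∑ u ∈ (Finset.univ.filter fun v ↦ p.idx v = i).erase (p.apex i), vertexVar K H u := by
      have hi : p.apex i ∈ Finset.univ.filter fun v ↦ p.idx v = i := by simp [p.idx_apex]
      rw [paramHom_X, ← Finset.add_sum_erase _ _ hi, add_sub_cancel_right]
    rw [this, sub_mul, ← smul_def, Finset.sum_mul]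
    refine N.sub_mem (N.smul_mem _ hx) (N.sum_mem fun u hu ↦ hcore u ?_ x hx)
    rintro j rfl
    simp only [Finset.mem_erase, Finset.mem_filter, p.idx_apex] at hu
    exact hu.1 (by rw [hu.2.2])
  have hspan : ⊤ ≤ N := by
    rintro x -
    obtain ⟨q, rfl⟩ := EdgeRing.mk_surjective K H x
    induction q using MvPolynomial.induction_on with
    | C a =>
      have : EdgeRing.mk K H (MvPolynomial.C a) =
          (MvPolynomial.C a : MvPolynomial (Fin r) K) • b ⟨∅, by simp [SimpleGraph.isIndepSet_iff]⟩ := by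
        rw [smul_def]
        simp only [b, Finset.prod_empty, mul_one]
        exact ((EdgeRing.mk K H).commutes a).trans ((p.paramHom K).commutes a).symm
      rw [this]
      exact N.smul_mem _ (Submodule.subset_span ⟨_, rfl⟩)
    | add q q' h h' => simpa using N.add_mem h h'
    | mul_X q v h =>
      rw [map_mul, mul_comm]
      exact hvar v _ h
  let B := Module.Basis.mk hli hspan
  exact ⟨Module.Finite.of_basis B, Module.Free.of_basis B⟩

include p in
theorem isCohenMacaulay : IsCohenMacaulay (EdgeRing K H) ∧
    ringKrullDim (EdgeRing K H) = (r : WithBot ℕ∞) := by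
  let := (p.paramHom K).toRingHom.toAlgebra
  obtain ⟨_, _⟩ := p.finite_and_free K
  have : Nontrivial (EdgeRing K H) :=
    (p.evalFace K ∅ (independenceComplex H).empty_mem).toRingHom.domain_nontrivial
  exact isCohenMacaulay_of_finite_flat K r _

end SimplicialPartition

/-! ### Application to hybrid graphs -/

/-- The blocks of a hybrid graph form a partition into cliques, each with a simplicial vertex. -/
noncomputable def hybridPartition {n r : ℕ} (G : SimpleGraph (Fin n)) (A : Fin r → Set (Fin n))
    (hdisj : ∀ i j : Fin r, i ≠ j → Disjoint (A i) (A j)) (hcover : ⋃ i, A i = Set.univ)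
    (s : Fin r → ℕ) (hs : ∀ i, 0 < s i) : SimplicialPartition (hybridGraph G A s) r :=
  have hex (a : Fin n) : ∃ i, a ∈ A i := Set.mem_iUnion.mp (hcover ▸ Set.mem_univ a)
  let idx : HybridVertex n s → Fin r := Sum.elim (fun a ↦ (hex a).choose) Sigma.fst
  have mem_block (v : HybridVertex n s) (i : Fin r) : v ∈ block A s i ↔ idx v = i := by
    rcases v with a | ⟨j, k⟩
    · have ha := (hex a).choose_spec
      have : a ∈ A i ↔ (hex a).choose = i := by
        refine ⟨fun h ↦ ?_, fun h ↦ h ▸ ha⟩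
        by_contra hne
        exact Set.disjoint_left.mp (hdisj _ _ hne) ha h
      simpa [block, idx] using this
    · simp only [block, Set.mem_union, Set.mem_image, reduceCtorEq, and_false, exists_false,
        Set.mem_range, Sum.inr.injEq, false_or, idx, Sum.elim_inr]
      constructor
      · rintro ⟨y, h⟩
        exact (congrArg Sigma.fst h).symm
      · rintro rfl
        exact ⟨k, rfl⟩
  { idx := idx
    -- The vertex y_{i,1}, available since s_i ≥ 1; all its edges lie in block i.
    apex := fun i ↦ Sum.inr ⟨i, ⟨0, hs i⟩⟩
    idx_apex := fun _ ↦ rfl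
    adj_of_idx_eq := fun u v hne h ↦
      Or.inr ⟨idx v, (mem_block u _).mpr h, (mem_block v _).mpr rfl, hne⟩
    idx_eq_of_adj_apex := by
      rintro i v (⟨a, b, -, h, -⟩ | ⟨j, hi, hv, -⟩)
      · cases h
      · rw [mem_block] at hi hv
        exact hv.trans hi.symm }

end CMHybrid

theorem theorem2p3 (K : Type*) [Field K] (n r : ℕ) (G : SimpleGraph (Fin n))
    (A : Fin r → Set (Fin n))
    (hdisj : ∀ i j : Fin r, i ≠ j → Disjoint (A i) (A j))
    (hcover : ⋃ i, A i = Set.univ)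
    (hclique : ∀ i, G.IsClique (A i))
    (s : Fin r → ℕ) (hs : ∀ i, 0 < s i) :
    ((CMHybrid.independenceComplex (CMHybrid.hybridGraph G A s)).IsPure ∧
      (CMHybrid.independenceComplex (CMHybrid.hybridGraph G A s)).IsShellable ∧
      (CMHybrid.independenceComplex (CMHybrid.hybridGraph G A s)).HasDim ((r : ℤ) - 1)) ∧
    (CMHybrid.IsCohenMacaulay (MvPolynomial (CMHybrid.HybridVertex n s) K ⧸
        CMHybrid.edgeIdeal K (CMHybrid.hybridGraph G A s)) ∧
      ringKrullDim (MvPolynomial (CMHybrid.HybridVertex n s) K ⧸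
        CMHybrid.edgeIdeal K (CMHybrid.hybridGraph G A s)) = (r : WithBot ℕ∞)) :=
  let p := CMHybrid.hybridPartition G A hdisj hcover s hs
  ⟨⟨p.isPure, p.isShellable, p.hasDim⟩, p.isCohenMacaulay K⟩
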